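/- For a group $X$, let $\sigma(X)$ denote the least positive integer $m$ such that $X$ is the union of $m$ proper subgroups (with $\sigma(X)=\infty$ if there is no such $m$). A group $X$ is called a primitive $n$-sum group if $\sigma(X)=n$ and $\sigma(X/N)\neq n$ for every nontrivial normal subgroup $N$ of $X$. Let $\Phi(G)$, $Z(G)$ and $\operatorname{Inn}(G)$ denote the Frattini subgroup, the centre and the group of inner automorphisms of $G$. Let $G$ be a finite soluble group with a non-normal abelian maximal subgroup of index $\sigma(G)-1$, where $\sigma(G)$ is finite. Then $\Phi(G)\leq Z(G)$, $G/\Phi(G)\cong \operatorname{Inn}(G)\times Z(G)/\Phi(G)$, and $\operatorname{Inn}(G)$ is a primitive $\sigma(G)$-sum group. -/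

import Mathlib

/-- The covering number `σ(G)`: the least number of proper subgroups of `G` whose union is `G`.
It is `⊤` if `G` is not a union of proper subgroups (for instance if `G` is cyclic). -/
noncomputable def coveringNumber (G : Type*) [Group G] : ℕ∞ :=
  sInf {n : ℕ∞ | ∃ S : Set (Subgroup G),
    (∀ H ∈ S, H ≠ ⊤) ∧ (∀ g : G, ∃ H ∈ S, g ∈ H) ∧ S.encard = n}

/-- `G` is a primitive `n`-sum group: `σ(G) = n`, and no quotient of `G` by a nontrivial normal
subgroup has covering number `n`. -/
def IsPrimitiveSumGroup (n : ℕ) (G : Type*) [Group G] : Prop :=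
  coveringNumber G = n ∧
    ∀ (N : Subgroup G) [N.Normal], N ≠ ⊥ → coveringNumber (G ⧸ N) ≠ n

/-- The group `Inn(G)` of inner automorphisms of `G`, as a subgroup of `Aut(G)`. -/
def innerAut (G : Type*) [Group G] : Subgroup (MulAut G) :=
  (MulAut.conj : G →* MulAut G).range

/-! Let `M` be the abelian maximal subgroup. Its normal core is `Z(G)` because the centraliser of
the core contains `M` and is normal. Hence `Φ(G) ≤ Z(G)`, and `Q = G / Z(G) ≅ Inn(G)` has the
core-free abelian maximal subgroup `C = M / Z(G)`.

A subgroup minimal among those supplementing `Z(G)` meets it inside `Φ(G)`. Multiplying such a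
supplement by `Φ(G)` gives a normal subgroup `H` with `Z(G) H = G` and `Z(G) ∩ H = Φ(G)`, whence the
direct decomposition of `G / Φ(G)`.

Solubility gives `Q` a nontrivial abelian normal subgroup `A`. As the centraliser of each nontrivial
element of `C` is `C`, the group `Q` is Frobenius with kernel `A` and complement `C`, so `A` and the
`A`-conjugates of `C` cover `Q` and `σ(Q) ≤ |A| + 1 = |G : M| + 1 = σ(G) ≤ σ(Q)`. Maximality of `C`
makes `A` a faithful irreducible `C`-module, so `C` embeds in the unit group of a field and is
cyclic. Every proper quotient of `Q` is an image of `C`, so it is cyclic and has `σ = ∞`.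
-/

section

variable {G : Type*} [Group G]

section Supplement

open Subgroup

theorem normal_of_center_sup_eq_top {H : Subgroup G} (h : center G ⊔ H = ⊤) : H.Normal :=
  normalizer_eq_top_iff.1 <| top_le_iff.1 <|
    h ▸ sup_le (center_le_normalizer (H : Set G)) le_normalizer

theorem normal_inf_of_sup_eq_top {A H : Subgroup G} [A.Normal] [IsMulCommutative A]
    (h : A ⊔ H = ⊤) : (A ⊓ H).Normal := by
  refine normalizer_eq_top_iff.1 (top_le_iff.1 (h ▸ sup_le ?_ ?_))
  · exact (A.le_centralizer.trans (centralizer_le inf_le_left)).trans (centralizer_le_normalizer _)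
  · exact (le_inf le_normalizer_of_normal le_normalizer).trans inf_normalizer_le_normalizer_inf

theorem inf_le_frattini_of_minimal {A H : Subgroup G} [A.Normal] [IsMulCommutative A]
    (hH : Minimal (fun K : Subgroup G => A ⊔ K = ⊤) H) : A ⊓ H ≤ frattini G := by
  refine le_iInf₂ fun L hL => ?_
  by_contra hle
  have hn : (A ⊓ H).Normal := normal_inf_of_sup_eq_top hH.prop
  have hLtop : A ⊓ H ⊔ L = ⊤ := (hL.not_le_iff_codisjoint.1 hle).symm.eq_top
  have hmod : H ≤ A ⊓ H ⊔ L ⊓ H := fun h hh => by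
    obtain ⟨a, ha, l, hl, rfl⟩ := mem_sup_of_normal_left.1 (hLtop ▸ mem_top h)
    exact mul_mem_sup ha ⟨hl, (H.mul_mem_cancel_left ha.2).1 hh⟩
  have hsup : A ⊔ L ⊓ H = ⊤ := top_le_iff.1 <| hH.prop ▸
    sup_le le_sup_left (hmod.trans (sup_le_sup_right inf_le_left _))
  exact hle (inf_le_right.trans ((hH.le_of_le hsup inf_le_right).trans inf_le_left))

theorem exists_sup_eq_top_inf_eq_frattini [WellFoundedLT (Subgroup G)] {A : Subgroup G}
    [A.Normal] [IsMulCommutative A] (hA : frattini G ≤ A) :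
    ∃ H : Subgroup G, A ⊔ H = ⊤ ∧ A ⊓ H = frattini G := by
  obtain ⟨H, hH⟩ := exists_minimal_of_wellFoundedLT (fun K : Subgroup G => A ⊔ K = ⊤)
    ⟨⊤, sup_top_eq A⟩
  refine ⟨frattini G ⊔ H, ?_, le_antisymm ?_ (le_inf hA le_sup_left)⟩
  · rw [← sup_assoc, sup_of_le_left hA, hH.prop]
  · rintro x ⟨hxA, hx⟩
    obtain ⟨f, hf, h, hh, rfl⟩ := mem_sup_of_normal_left.1 hx
    exact mul_mem hf (inf_le_frattini_of_minimal hH ⟨(A.mul_mem_cancel_left (hA hf)).1 hxA, hh⟩)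

end Supplement

section ProductDecomposition

open Subgroup

theorem mk'_comp_subtype_surjective {N H : Subgroup G} [N.Normal] (h : H ⊔ N = ⊤) :
    Function.Surjective ((QuotientGroup.mk' N).comp H.subtype) := by
  intro q
  obtain ⟨x, rfl⟩ := QuotientGroup.mk'_surjective N q
  obtain ⟨k, hk, n, hn, rfl⟩ := mem_sup_of_normal_right.1 (h ▸ mem_top x)
  exact ⟨⟨k, hk⟩, QuotientGroup.eq.2 (by simpa using hn)⟩

/-- The second isomorphism theorem `H / (H ∩ N) ≃ G / N` when `HN = G`, used to identify
`Z(G) / Φ(G)` with a quotient of `G`. -/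
noncomputable def quotientSubgroupOfMulEquiv {N H : Subgroup G} [N.Normal] (h : H ⊔ N = ⊤) :
    H ⧸ N.subgroupOf H ≃* G ⧸ N :=
  (QuotientGroup.quotientMulEquivOfEq (by
    rw [← MonoidHom.comap_ker, QuotientGroup.ker_mk', subgroupOf])).trans
    (QuotientGroup.quotientKerEquivOfSurjective _ (mk'_comp_subtype_surjective h))

theorem mk'_prod_mk'_surjective {A B : Subgroup G} [A.Normal] [B.Normal] (h : A ⊔ B = ⊤) :
    Function.Surjective ((QuotientGroup.mk' A).prod (QuotientGroup.mk' B)) := by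
  rintro ⟨p, q⟩
  obtain ⟨b, rfl⟩ := mk'_comp_subtype_surjective ((sup_comm B A).trans h) p
  obtain ⟨a, rfl⟩ := mk'_comp_subtype_surjective h q
  refine ⟨b * a, Prod.ext ?_ ?_⟩
  · exact QuotientGroup.mk_mul_of_mem (b : G) a.2
  · change ((b * a : G) : G ⧸ B) = (a : G)
    rw [QuotientGroup.mk_mul, (QuotientGroup.eq_one_iff (b : G)).2 b.2, one_mul]

/-- The isomorphism `G / (A ∩ B) ≃ G / A × G / B` when `AB = G`, which splits `G / Φ(G)`. -/
noncomputable def quotientInfMulEquivProd {A B : Subgroup G} [A.Normal] [B.Normal]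
    (h : A ⊔ B = ⊤) : G ⧸ A ⊓ B ≃* (G ⧸ A) × (G ⧸ B) :=
  (QuotientGroup.quotientMulEquivOfEq (by
    rw [MonoidHom.ker_prod, QuotientGroup.ker_mk', QuotientGroup.ker_mk'])).trans
    (QuotientGroup.quotientKerEquivOfSurjective _ (mk'_prod_mk'_surjective h))

theorem ker_conj : (MulAut.conj : G →* MulAut G).ker = center G := by
  ext g
  simp only [MonoidHom.mem_ker, mem_center_iff, MulEquiv.ext_iff, MulAut.conj_apply,
    MulAut.one_apply, mul_inv_eq_iff_eq_mul]
  exact forall_congr' fun x => eq_comm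

/-- The isomorphism `G / Z(G) ≃ Inn(G)` induced by conjugation. -/
noncomputable def quotientCenterMulEquivInnerAut (G : Type*) [Group G] :
    G ⧸ center G ≃* innerAut G :=
  (QuotientGroup.quotientMulEquivOfEq ker_conj.symm).trans
    (QuotientGroup.quotientKerEquivRange MulAut.conj)

theorem nonempty_quotient_frattini_mulEquiv [WellFoundedLT (Subgroup G)]
    (hΦ : frattini G ≤ center G) :
    Nonempty (G ⧸ frattini G ≃*
      innerAut G × (center G ⧸ (frattini G).subgroupOf (center G))) := by
  obtain ⟨H, hsup, hinf⟩ := exists_sup_eq_top_inf_eq_frattini hΦ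
  have hH : H.Normal := normal_of_center_sup_eq_top hsup
  have hΦH : (frattini G).subgroupOf (center G) = H.subgroupOf (center G) := by
    rw [← hinf, inf_subgroupOf_left]
  exact ⟨(QuotientGroup.quotientMulEquivOfEq hinf.symm).trans <|
    (quotientInfMulEquivProd hsup).trans <|
    (quotientCenterMulEquivInnerAut G).prodCongr <|
    (quotientSubgroupOfMulEquiv hsup).symm.trans <|
    QuotientGroup.quotientMulEquivOfEq hΦH.symm⟩

end ProductDecomposition

section CoveringNumber

theorem coveringNumber_le_encard {S : Set (Subgroup G)} (hS : ∀ H ∈ S, H ≠ ⊤)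
    (hcover : ∀ g : G, ∃ H ∈ S, g ∈ H) : coveringNumber G ≤ S.encard :=
  sInf_le ⟨S, hS, hcover, rfl⟩

theorem coveringNumber_le_of_surjective {Q : Type*} [Group Q] {f : G →* Q}
    (hf : Function.Surjective f) : coveringNumber G ≤ coveringNumber Q := by
  refine le_sInf ?_
  rintro _ ⟨S, hS, hcover, rfl⟩
  refine (coveringNumber_le_encard (S := Subgroup.comap f '' S) ?_ fun g => ?_).trans
    (Set.encard_image_le _ _)
  · rintro _ ⟨H, hH, rfl⟩ htop
    exact hS H hH (Subgroup.comap_injective hf (htop.trans (Subgroup.comap_top f).symm))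
  · obtain ⟨H, hH, hg⟩ := hcover (f g)
    exact ⟨H.comap f, ⟨H, hH, rfl⟩, hg⟩

theorem coveringNumber_eq_top_of_isCyclic [IsCyclic G] : coveringNumber G = ⊤ := by
  refine sInf_eq_top.2 ?_
  rintro _ ⟨S, hS, hcover, -⟩
  obtain ⟨g, hg⟩ := IsCyclic.exists_generator (α := G)
  obtain ⟨H, hH, hgH⟩ := hcover g
  exact absurd (top_le_iff.1 fun x _ => Subgroup.zpowers_le.2 hgH (hg x)) (hS H hH)

end CoveringNumber

section Frobenius

open Subgroup

/-- `G` is a Frobenius group with kernel `A` and complement `M`, expressed as a semidirect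
product decomposition in which nontrivial elements of `M` act on `A` without nontrivial fixed
points. -/
structure IsFrobeniusDecomposition (A M : Subgroup G) [A.Normal] : Prop where
  isComplement' : A.IsComplement' M
  fixedPointFree : ∀ m ∈ M, m ≠ 1 → MonoidHom.FixedPointFree (MulAut.conjNormal m : MulAut A)
  kernel_ne_bot : A ≠ ⊥
  complement_ne_bot : M ≠ ⊥

variable {A M : Subgroup G} [A.Normal]

namespace IsFrobeniusDecomposition

theorem exists_conj_mem [Finite A] (h : IsFrobeniusDecomposition A M) {g : G} (hg : g ∉ A) :
    ∃ a ∈ A, a⁻¹ * g * a ∈ M := by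
  obtain ⟨⟨b, m⟩, rfl⟩ := h.isComplement'.2 g
  have hm : (m : G) ≠ 1 := fun e => hg (by simp [e])
  obtain ⟨a, ha⟩ := (h.fixedPointFree m m.2 hm).commutatorMap_surjective b
  refine ⟨a, a.2, ?_⟩
  have hb : (a : G) / (m * a * (m : G)⁻¹) = b := congrArg Subtype.val ha
  have hconj : (a : G)⁻¹ * (b * m) * a = m := by
    simp only [← hb, div_eq_mul_inv]; group
  exact hconj ▸ m.2

theorem coveringNumber_le_index_add_one [Finite A] (h : IsFrobeniusDecomposition A M) :
    coveringNumber G ≤ (M.index + 1 : ℕ) := by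
  let C : A → Subgroup G := fun a => (MulAut.conj (a : G)).mapSubgroup M
  have hproper : ∀ H ∈ insert A (Set.range C), H ≠ ⊤ := by
    rintro _ (rfl | ⟨a, rfl⟩) htop
    · exact h.complement_ne_bot (top_disjoint.1 (htop ▸ h.isComplement'.disjoint))
    · have hM : M = ⊤ := (MulAut.conj (a : G)).mapSubgroup.injective
        (htop.trans (OrderIso.map_top _).symm)
      exact h.kernel_ne_bot (disjoint_top.1 (hM ▸ h.isComplement'.disjoint))
  have hcover : ∀ g, ∃ H ∈ insert A (Set.range C), g ∈ H := fun g => by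
    by_cases hg : g ∈ A
    · exact ⟨A, Set.mem_insert _ _, hg⟩
    · obtain ⟨a, ha, hM⟩ := h.exists_conj_mem hg
      exact ⟨C ⟨a, ha⟩, Set.mem_insert_of_mem _ ⟨_, rfl⟩, _, hM, by simp [mul_assoc]⟩
  calc coveringNumber G ≤ (insert A (Set.range C)).encard :=
        coveringNumber_le_encard hproper hcover
    _ ≤ (Set.range C).encard + 1 := Set.encard_insert_le _ _
    _ ≤ ENat.card A + 1 := by
        gcongr
        rw [← Set.image_univ, ← Set.encard_univ]
        exact Set.encard_image_le _ _
    _ = (M.index + 1 : ℕ) := by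
        rw [h.isComplement'.index_eq_card, ENat.card_eq_coe_natCard, Nat.cast_add, Nat.cast_one]

end IsFrobeniusDecomposition

end Frobenius

section FaithfulIrreducible

open scoped MonoidAlgebra

theorem isCyclic_of_injective_of_isSimpleModule {k V M : Type*} [CommRing k] [AddCommGroup V]
    [Module k V] [CommGroup M] [Finite M] {ρ : Representation k M V}
    [IsSimpleModule k[M] ρ.asModule] (hρ : Function.Injective ρ) : IsCyclic M := by
  let I := Module.annihilator k[M] ρ.asModule
  -- As `k[M]` is commutative, `k[M] ⧸ I` is a field; `M` embeds in its unit group.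
  have hI : I.IsMaximal := IsSimpleModule.annihilator_isMaximal
  let F : M →* k[M] ⧸ I := (Ideal.Quotient.mk I : k[M] →* k[M] ⧸ I).comp (MonoidAlgebra.of k M)
  refine isCyclic_of_injective_ringHom F fun x y hxy => hρ (LinearMap.ext fun v => ?_)
  have hann : MonoidAlgebra.of k M x - MonoidAlgebra.of k M y ∈ I := Ideal.Quotient.eq.1 hxy
  have hv := Module.mem_annihilator.1 hann (ρ.asModuleEquiv.symm v)
  rwa [sub_smul, sub_eq_zero, ← ρ.asModuleEquiv_symm_map_rho, ← ρ.asModuleEquiv_symm_map_rho,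
    ρ.asModuleEquiv.symm.injective.eq_iff] at hv

theorem isSimpleModule_ofMulDistribMulAction {M A : Type*} [Monoid M] [CommGroup A] [Nontrivial A]
    [MulDistribMulAction M A]
    (h : ∀ K : Subgroup A, (∀ m : M, ∀ k ∈ K, m • k ∈ K) → K = ⊥ ∨ K = ⊤) :
    IsSimpleModule ℤ[M] (Representation.ofMulDistribMulAction M A).asModule := by
  let ρ := Representation.ofMulDistribMulAction M A
  have : Nontrivial (Submodule ℤ[M] ρ.asModule) :=
    (Submodule.nontrivial_iff ℤ[M]).2 (inferInstanceAs (Nontrivial (Additive A)))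
  refine (isSimpleModule_iff _ _).2 ⟨fun W => ?_⟩
  let K : Subgroup A := AddSubgroup.toSubgroup' W.toAddSubgroup
  have hK : ∀ m : M, ∀ k ∈ K, m • k ∈ K := fun m k hk => by
    have hW : MonoidAlgebra.of ℤ M m • ρ.asModuleEquiv.symm (Additive.ofMul k) ∈ W :=
      W.smul_mem _ hk
    rwa [← ρ.asModuleEquiv_symm_map_rho] at hW
  refine (h K hK).imp (fun hbot => le_bot_iff.1 fun w hw => ?_)
    fun htop => top_le_iff.1 fun w _ => ?_
  · have hwK : Additive.toMul (ρ.asModuleEquiv w) ∈ K := hw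
    rwa [hbot] at hwK
  · exact (htop ▸ Subgroup.mem_top _ : Additive.toMul (ρ.asModuleEquiv w) ∈ K)

theorem isCyclic_of_faithfulSMul {M A : Type*} [CommGroup M] [Finite M] [CommGroup A]
    [Nontrivial A] [MulDistribMulAction M A] [FaithfulSMul M A]
    (h : ∀ K : Subgroup A, (∀ m : M, ∀ k ∈ K, m • k ∈ K) → K = ⊥ ∨ K = ⊤) : IsCyclic M := by
  have := isSimpleModule_ofMulDistribMulAction h
  refine isCyclic_of_injective_of_isSimpleModule
    (ρ := Representation.ofMulDistribMulAction M A) fun x y hxy => ?_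
  exact FaithfulSMul.eq_of_smul_eq_smul fun a : A => DFunLike.congr_fun hxy (Additive.ofMul a)

end FaithfulIrreducible

section MaximalSubgroup

open Subgroup

variable {M : Subgroup G}

theorem normalCore_eq_center [IsMulCommutative M] (hM : IsCoatom M) (hn : ¬ M.Normal) :
    M.normalCore = center G := by
  refine le_antisymm ?_ (normal_le_normalCore.2 ?_)
  · have hle : M ≤ centralizer (M.normalCore : Set G) :=
      M.le_centralizer.trans (centralizer_le M.normalCore_le)
    have hne : centralizer (M.normalCore : Set G) ≠ M := fun e => hn (e ▸ inferInstance)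
    exact centralizer_eq_top_iff_subset.1 ((hM.ne_iff_eq_top hle).1 hne)
  · by_contra h
    exact hn (normal_of_center_sup_eq_top (hM.not_le_iff_codisjoint.1 h).symm.eq_top)

theorem centralizer_singleton_eq [IsMulCommutative M] (hM : IsCoatom M) {m : G} (hm : m ∈ M)
    (hmZ : m ∉ center G) : centralizer {m} = M := by
  refine (hM.ne_top_iff_eq ?_).1 fun htop => ?_
  · exact M.le_centralizer.trans (centralizer_le (Set.singleton_subset_iff.2 hm))
  · exact hmZ (Set.singleton_subset_iff.1 (centralizer_eq_top_iff_subset.1 htop))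

theorem isCoatom_map_of_ker_le {Q : Type*} [Group Q] {f : G →* Q} (hf : Function.Surjective f)
    (hker : f.ker ≤ M) (hM : IsCoatom M) : IsCoatom (M.map f) := by
  have hcomap : (M.map f).comap f = M := comap_map_eq_self hker
  refine ⟨fun h => hM.1 (by rw [← hcomap, h, comap_top]), fun L hL => comap_injective hf ?_⟩
  rw [comap_top]
  exact hM.2 _ (hcomap ▸ (comap_lt_comap_of_surjective hf).2 hL)

theorem normalCore_map_eq_bot {Q : Type*} [Group Q] {f : G →* Q} (hf : Function.Surjective f)
    (hker : f.ker = M.normalCore) : (M.map f).normalCore = ⊥ := by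
  have hcomap : (M.map f).comap f = M := comap_map_eq_self (hker.trans_le M.normalCore_le)
  have hle : (M.map f).normalCore.comap f ≤ M.normalCore :=
    normal_le_normalCore.2 ((comap_mono (normalCore_le _)).trans_eq hcomap)
  rw [eq_bot_iff, ← comap_le_comap_of_surjective hf, MonoidHom.comap_bot, hker]
  exact hle

open scoped Pointwise in
theorem eq_bot_or_eq_of_le_normalizer {A K : Subgroup G} (hM : IsCoatom M) (hAM : Disjoint A M)
    (hKA : K ≤ A) (hK : M ≤ normalizer K) : K = ⊥ ∨ K = A := by
  refine or_iff_not_imp_left.2 fun hne => le_antisymm hKA fun a ha => ?_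
  have hKM : ¬ K ≤ M := fun hle => hne (disjoint_self.1 (hAM.mono hKA hle))
  have hsup : K ⊔ M = ⊤ := (hM.not_le_iff_codisjoint.1 hKM).symm.eq_top
  obtain ⟨k, hk, m, hm, rfl⟩ : a ∈ (K : Set G) * (M : Set G) := by
    rw [← coe_mul_of_right_le_normalizer_left K M hK, hsup]; trivial
  have hm1 : m = 1 :=
    disjoint_def.1 hAM ((A.mul_mem_cancel_left (hKA hk)).1 ha) hm
  simpa [hm1] using hk

end MaximalSubgroup

section CoreFree

open Subgroup

variable {A M : Subgroup G} [A.Normal]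

theorem isComplement'_of_normalCore_eq_bot [IsMulCommutative A] (hM : IsCoatom M)
    (hcore : M.normalCore = ⊥) (hA : A ≠ ⊥) : A.IsComplement' M := by
  have hsup : A ⊔ M = ⊤ := (hM.not_le_iff_codisjoint.1 fun hle =>
    hA (le_bot_iff.1 (hcore ▸ normal_le_normalCore.2 hle))).symm.eq_top
  have hn : (A ⊓ M).Normal := normal_inf_of_sup_eq_top hsup
  refine isComplement'_of_disjoint_and_mul_eq_univ (disjoint_iff_inf_le.2 ?_) ?_
  · exact hcore ▸ normal_le_normalCore.2 inf_le_right
  · rw [← normal_mul, hsup, coe_top]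

theorem isFrobeniusDecomposition_of_isCoatom [IsMulCommutative A] [IsMulCommutative M]
    (hM : IsCoatom M) (hn : ¬ M.Normal) (hcore : M.normalCore = ⊥) (hA : A ≠ ⊥) :
    IsFrobeniusDecomposition A M where
  isComplement' := isComplement'_of_normalCore_eq_bot hM hcore hA
  fixedPointFree m hm hm1 a ha := by
    have hmZ : m ∉ center G := by
      rwa [← normalCore_eq_center hM hn, hcore, mem_bot]
    have haM : (a : G) ∈ M := by
      rw [← centralizer_singleton_eq hM hm hmZ, mem_centralizer_singleton_iff]
      exact (mul_inv_eq_iff_eq_mul.1 (congrArg Subtype.val ha)).symm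
    exact Subtype.ext (disjoint_def.1
      (isComplement'_of_normalCore_eq_bot hM hcore hA).disjoint a.2 haM)
  kernel_ne_bot := hA
  complement_ne_bot h := hn (h ▸ inferInstance)

open scoped IsMulCommutative in
theorem IsFrobeniusDecomposition.isCyclic_complement [IsMulCommutative A]
    [IsMulCommutative M] [Finite M] (h : IsFrobeniusDecomposition A M) (hM : IsCoatom M) :
    IsCyclic M := by
  let : MulDistribMulAction M A :=
    MulDistribMulAction.compHom A ((MulAut.conjNormal (H := A)).comp M.subtype)
  have : Nontrivial A := A.nontrivial_iff_ne_bot.2 h.kernel_ne_bot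
  obtain ⟨a, ha⟩ := exists_ne (1 : A)
  have : FaithfulSMul M A := ⟨fun {x y} hxy => by
    have hfix : (y⁻¹ * x) • a = a := by rw [mul_smul, hxy, inv_smul_smul]
    by_contra hne
    refine ha (h.fixedPointFree (y⁻¹ * x : M) (y⁻¹ * x).2 (fun e => hne ?_) a hfix)
    exact (inv_mul_eq_one.1 (Subtype.ext e)).symm⟩
  refine isCyclic_of_faithfulSMul (A := A) fun K hK => ?_
  have hnorm : M ≤ normalizer (K.map A.subtype : Set G) := by
    refine le_normalizer_iff.2 ?_
    rintro m hm _ ⟨k, hk, rfl⟩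
    exact ⟨_, hK ⟨m, hm⟩ k hk, rfl⟩
  refine (eq_bot_or_eq_of_le_normalizer hM h.isComplement'.disjoint (map_subtype_le K) hnorm).imp
    (fun hbot => ?_) fun htop => ?_
  · exact (map_eq_bot_iff_of_injective _ A.subtype_injective).1 hbot
  · exact map_injective A.subtype_injective
      (htop.trans (A.range_subtype.symm.trans (MonoidHom.range_eq_map _)))

theorem isCyclic_quotient_of_sup_eq_top {N : Subgroup G} [N.Normal] [IsCyclic M]
    (h : M ⊔ N = ⊤) : IsCyclic (G ⧸ N) :=
  isCyclic_of_surjective _ (mk'_comp_subtype_surjective h)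

end CoreFree

section Solvable

open Subgroup

theorem exists_normal_isMulCommutative_ne_bot (G : Type*) [Group G] [Group.IsSolvable G]
    [Nontrivial G] : ∃ A : Subgroup G, A.Normal ∧ IsMulCommutative A ∧ A ≠ ⊥ := by
  classical
  have hs := (Group.isSolvable_def G).1 ‹_›
  obtain ⟨k, hk⟩ : ∃ k, Nat.find hs = k + 1 := Nat.exists_eq_succ_of_ne_zero fun h0 =>
    top_ne_bot (h0 ▸ Nat.find_spec hs : derivedSeries G 0 = ⊥)
  have hcomm : ⁅derivedSeries G k, derivedSeries G k⁆ = ⊥ :=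
    (hk ▸ Nat.find_spec hs : derivedSeries G (k + 1) = ⊥)
  exact ⟨derivedSeries G k, derivedSeries_normal G k,
    le_centralizer_iff_isMulCommutative.1 (commutator_eq_bot_iff_le_centralizer.1 hcomm),
    Nat.find_min hs (by omega)⟩

theorem finite_of_normalCore_eq_bot {M : Subgroup G} [M.FiniteIndex] (h : M.normalCore = ⊥) :
    Finite G :=
  have : (⊥ : Subgroup G).FiniteIndex := h ▸ inferInstance
  .of_equiv _ (QuotientGroup.quotientBot (G := G)).toEquiv

theorem isPrimitiveSumGroup_of_normalCore_eq_bot [Group.IsSolvable G] {M : Subgroup G}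
    [M.FiniteIndex] [IsMulCommutative M] (hM : IsCoatom M) (hn : ¬ M.Normal)
    (hcore : M.normalCore = ⊥) (hσ : (M.index + 1 : ℕ) ≤ coveringNumber G) :
    IsPrimitiveSumGroup (M.index + 1) G := by
  have : Finite G := finite_of_normalCore_eq_bot hcore
  have : Nontrivial G := (subsingleton_or_nontrivial G).resolve_left fun _ =>
    hM.1 (Subsingleton.elim M ⊤)
  obtain ⟨A, hAn, hAc, hA⟩ := exists_normal_isMulCommutative_ne_bot G
  have hF := isFrobeniusDecomposition_of_isCoatom hM hn hcore hA
  have : IsCyclic M := hF.isCyclic_complement hM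
  refine ⟨le_antisymm hF.coveringNumber_le_index_add_one hσ, fun N _ hN => ?_⟩
  have hNM : ¬ N ≤ M := fun hle => hN (le_bot_iff.1 (hcore ▸ normal_le_normalCore.2 hle))
  have := isCyclic_quotient_of_sup_eq_top (hM.not_le_iff_codisjoint.1 hNM).eq_top
  rw [coveringNumber_eq_top_of_isCyclic]
  exact ENat.top_ne_natCast _

theorem isPrimitiveSumGroup_innerAut [Group.IsSolvable G] {M : Subgroup G}
    [M.FiniteIndex] [IsMulCommutative M] (hM : IsCoatom M) (hn : ¬ M.Normal)
    (hσ : (M.index + 1 : ℕ) ≤ coveringNumber G) :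
    IsPrimitiveSumGroup (M.index + 1) (innerAut G) := by
  let π : G →* innerAut G := MulAut.conj.rangeRestrict
  have hπ : Function.Surjective π := MonoidHom.rangeRestrict_surjective _
  have hker : π.ker = M.normalCore := by
    rw [normalCore_eq_center hM hn]
    exact (MonoidHom.ker_rangeRestrict _).trans ker_conj
  have hkerM : π.ker ≤ M := hker.trans_le M.normalCore_le
  have hindex : (M.map π).index = M.index := index_map_eq M hπ hkerM
  have : (M.map π).FiniteIndex := ⟨hindex ▸ FiniteIndex.index_ne_zero⟩
  have : Group.IsSolvable (innerAut G) := Group.isSolvable_of_surjective hπ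
  have hn' : ¬ (M.map π).Normal := fun h =>
    hn (comap_map_eq_self hkerM ▸ h.comap π)
  rw [← hindex] at hσ ⊢
  exact isPrimitiveSumGroup_of_normalCore_eq_bot (isCoatom_map_of_ker_le hπ hkerM hM) hn'
    (normalCore_map_eq_bot hπ hker) (hσ.trans (coveringNumber_le_of_surjective hπ))

end Solvable

end

theorem corollary3p1p5_general {G : Type*} [Group G] [WellFoundedLT (Subgroup G)]
    [Group.IsSolvable G] (n : ℕ) (hσ : coveringNumber G = n)
    (M : Subgroup G) [M.FiniteIndex] (hMmax : IsCoatom M) (hMnormal : ¬ M.Normal)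
    (hMcomm : IsMulCommutative M) (hMindex : M.index + 1 = n) :
    frattini G ≤ Subgroup.center G ∧
    Nonempty (G ⧸ frattini G ≃*
      innerAut G × (Subgroup.center G ⧸ (frattini G).subgroupOf (Subgroup.center G))) ∧
    IsPrimitiveSumGroup n (innerAut G) := by
  have hΦ : frattini G ≤ Subgroup.center G :=
    normalCore_eq_center hMmax hMnormal ▸
      Subgroup.normal_le_normalCore.2 (frattini_le_coatom hMmax)
  subst hMindex
  exact ⟨hΦ, nonempty_quotient_frattini_mulEquiv hΦ,
    isPrimitiveSumGroup_innerAut hMmax hMnormal hσ.ge⟩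

theorem corollary3p1p5 {G : Type*} [Group G] [Finite G] [Group.IsSolvable G]
    (n : ℕ) (hσ : coveringNumber G = n)
    (M : Subgroup G) (hMmax : IsCoatom M) (hMnormal : ¬ M.Normal) (hMcomm : IsMulCommutative M)
    (hMindex : M.index + 1 = n) :
    frattini G ≤ Subgroup.center G ∧
    Nonempty (G ⧸ frattini G ≃*
      innerAut G × (Subgroup.center G ⧸ (frattini G).subgroupOf (Subgroup.center G))) ∧
    IsPrimitiveSumGroup n (innerAut G) :=
  corollary3p1p5_general n hσ M hMmax hMnormal hMcomm hMindex
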